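/- Let $\mathbb{G}$ be a homogeneous Lie group, realised on a finite-dimensional real vector space ($\cong\mathbb{R}^N$) with the origin $0$ as identity: the group operations $\circ$ and $x\mapsto x^{-1}$ are smooth, and there is a diagonalisable linear operator $A$ with positive eigenvalues such that the dilations $D_\lambda=\mathrm{Exp}(A\ln\lambda)$, $\lambda>0$, are automorphisms both of the Lie algebra and of the group; write $\lambda x=D_\lambda x$ and let $Q=\mathrm{Tr}\,A$ be the homogeneous dimension. Fix a Haar measure $dx$ on $\mathbb{G}$ and a homogeneous quasi-norm $q$, that is, a continuous function $q:\mathbb{G}\to[0,\infty)$ with $q(x^{-1})=q(x)$, $q(\lambda x)=\lambda q(x)$ for $\lambda>0$, and $q(x)=0$ if and only if $x=0$. Let $p>1$ and $s\in(0,1)$ be such that $Q>sp$, and put $$[u]_{s,p,q}=\left(\int_{\mathbb{G}}\int_{\mathbb{G}}\frac{|u(x)-u(y)|^{p}}{q^{Q+sp}(y^{-1}\circ x)}\,dx\,dy\right)^{1/p}.$$ For a Haar measurable set $\Omega\subset\mathbb{G}$ let $W_0^{s,p,q}(\Omega)$ be the completion of $C_0^\infty(\Omega)$ (smooth functions on $\mathbb{G}$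 with compact support contained in $\Omega$) with respect to the norm $\|u\|_{L^p(\mathbb{G})}+[u]_{s,p,q}$, that is, the set of functions $u\in L^p(\mathbb{G})$ with $[u]_{s,p,q}<\infty$ that are limits in this norm of sequences in $C_0^\infty(\Omega)$. For a function $\omega$ on $\Omega$, a function $u\in W_0^{s,p,q}(\Omega)$ is a weak solution of the Dirichlet problem $$(-\Delta_{p,q})^s u=\omega|u|^{p-2}u\ \text{ in }\Omega,\qquad u=0\ \text{ in }\mathbb{G}\setminus\Omega,$$ if $u=0$ almost everywhere in $\mathbb{G}\setminus\Omega$ and $$\int_{\mathbb{G}}\int_{\mathbb{G}}\frac{|u(x)-u(y)|^{p-2}(u(x)-u(y))(v(x)-v(y))}{q^{Q+sp}(y^{-1}\circ x)}\,dx\,dy=\int_\Omega \omega(x)|u(x)|^{p-2}u(x)v(x)\,dx\qquad\text{for all } v\in W_0^{s,p,q}(\Omega).$$ Let $r_{\Omega,q}=\sup\{q(x):x\in\Omega\}\in[0,\infty]$. Theorem (Lyapunov-type inequality). There is a constant $C>0$, depending only on $Q,p,s,q$ (and the group and its fixed Haar measure), such that the following holds for every Haar measurable set $\Omega\subset\mathbb{G}$,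 every $\theta$ with $\frac{Q}{sp}<\theta<\infty$ and every $\omega\in L^\theta(\Omega)$ with $\omega\ge0$ almost everywhere in $\Omega$. If the Dirichlet problem above has a weak solution $u\in W_0^{s,p,q}(\Omega)$ that is nontrivial (not almost everywhere $0$), then $$\|\omega\|_{L^\theta(\Omega)}\ge\frac{C}{r_{\Omega,q}^{\,sp-Q/\theta}},$$ where the right-hand side is $0$ if $r_{\Omega,q}=\infty$. -/

import Mathlib

open MeasureTheory Filter Topology
open scoped ENNReal ContDiff Manifold

noncomputable section

namespace HomGroup

/-- The dilation `D_t = Exp (A ln t)` generated by the linear operator `A`. -/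
def dilation {V : Type*} [NormedAddCommGroup V] [NormedSpace ℝ V] (A : V →L[ℝ] V) (t : ℝ) :
    V →L[ℝ] V :=
  NormedSpace.exp (Real.log t • A)

/-- The dilation `D_t` as a map of the Lie algebra of the Lie group `V`, that is, of the tangent
space of `V` at the identity, which is `V` itself. -/
def lieDilation {V : Type*} [NormedAddCommGroup V] [NormedSpace ℝ V] [Group V]
    (A : V →L[ℝ] V) (t : ℝ) (X : GroupLieAlgebra 𝓘(ℝ, V) V) : GroupLieAlgebra 𝓘(ℝ, V) V :=
  dilation A t X

/-- A homogeneous Lie group, realised on a finite-dimensional real vector space `V` (a copy of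
`ℝ^N`, identified with the Lie algebra).  The group law of `V` (written multiplicatively, and not
to be confused with the vector addition) is the instance `[Group V]`; it is required to make the
manifold `V`, which is connected and simply connected, into a Lie group.  The identity is the
origin, and `A` is a diagonalisable operator with positive eigenvalues whose
dilations `D_t = Exp (A ln t)` respect the Lie bracket of the Lie algebra of the group and, acting
on the group itself, are group automorphisms. -/
structure HomogeneousGroup (V : Type*) [NormedAddCommGroup V] [NormedSpace ℝ V]
    [FiniteDimensional ℝ V] [Group V] where
  /-- the group operations are smooth -/
  lieGroup : LieGroup 𝓘(ℝ, V) ∞ V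
  /-- the origin of `V` is the identity of the group -/
  one_eq_zero : (1 : V) = 0
  /-- the generator of the dilations -/
  A : V →L[ℝ] V
  /-- `A` is diagonalisable: its eigenspaces span `V` -/
  diagonalizable : ⨆ ν : ℝ, Module.End.eigenspace (A : V →ₗ[ℝ] V) ν = ⊤
  /-- the eigenvalues of `A` are positive -/
  eigenvalue_pos : ∀ ν : ℝ, Module.End.HasEigenvalue (A : V →ₗ[ℝ] V) ν → 0 < ν
  /-- the dilations are morphisms of the Lie algebra (the tangent space at the identity) -/
  dilation_bracket : ∀ t : ℝ, 0 < t → ∀ X Y : GroupLieAlgebra 𝓘(ℝ, V) V,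
    ⁅lieDilation A t X, lieDilation A t Y⁆ = lieDilation A t ⁅X, Y⁆
  /-- the dilations are morphisms of the group -/
  dilation_mul : ∀ t : ℝ, 0 < t → ∀ x y : V,
    dilation A t (x * y) = dilation A t x * dilation A t y

variable {V : Type*} [NormedAddCommGroup V] [NormedSpace ℝ V] [FiniteDimensional ℝ V] [Group V]

/-- The homogeneous dimension `Q = Tr A`. -/
def HomogeneousGroup.homDim (H : HomogeneousGroup V) : ℝ :=
  LinearMap.trace ℝ V (H.A : V →ₗ[ℝ] V)

/-- Homogeneous quasi-norms on the homogeneous group. -/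
structure HomogeneousGroup.IsQuasiNorm (H : HomogeneousGroup V) (q : V → ℝ) : Prop where
  continuous : Continuous q
  nonneg : ∀ x, 0 ≤ q x
  inv : ∀ x, q x⁻¹ = q x
  homogeneous : ∀ t : ℝ, 0 < t → ∀ x, q (dilation H.A t x) = t * q x
  eq_zero_iff : ∀ x, q x = 0 ↔ x = 0

/-- The Gagliardo seminorm `[u]_{s,p,q}` over the whole group, with values in `[0,∞]`. -/
def HomogeneousGroup.gagliardo (H : HomogeneousGroup V) [MeasurableSpace V] (μ : Measure V)
    (q : V → ℝ) (s p : ℝ) (u : V → ℝ) : ℝ≥0∞ :=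
  (∫⁻ z : V × V, ENNReal.ofReal (|u z.1 - u z.2| ^ p / q (z.2⁻¹ * z.1) ^ (H.homDim + s * p))
    ∂(μ.prod μ)) ^ (1 / p)

/-- The norm `‖u‖_{L^p} + [u]_{s,p,q}` of the fractional Sobolev space `W^{s,p,q}`. -/
def HomogeneousGroup.sobolevNorm (H : HomogeneousGroup V) [MeasurableSpace V] (μ : Measure V)
    (q : V → ℝ) (s p : ℝ) (u : V → ℝ) : ℝ≥0∞ :=
  eLpNorm u (ENNReal.ofReal p) μ + H.gagliardo μ q s p u

/-- `W^{s,p,q}`: measurable functions in `L^p` with finite Gagliardo seminorm. -/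
def HomogeneousGroup.MemSobolev (H : HomogeneousGroup V) [MeasurableSpace V] (μ : Measure V)
    (q : V → ℝ) (s p : ℝ) (u : V → ℝ) : Prop :=
  MemLp u (ENNReal.ofReal p) μ ∧ H.gagliardo μ q s p u < ⊤

/-- `C_0^∞(Ω)`: smooth functions with compact support contained in `Ω`. -/
def IsTestFunction (Ω : Set V) (φ : V → ℝ) : Prop :=
  ContDiff ℝ ∞ φ ∧ HasCompactSupport φ ∧ tsupport φ ⊆ Ω

/-- `W_0^{s,p,q}(Ω)`, the completion of `C_0^∞(Ω)` for the Sobolev norm: since `W^{s,p,q}` is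
complete it is the closure of `C_0^∞(Ω)` in `W^{s,p,q}`.  Its elements are functions on the whole
group, vanishing almost everywhere outside `Ω`. -/
def HomogeneousGroup.MemSobolevZero (H : HomogeneousGroup V) [MeasurableSpace V] (μ : Measure V)
    (q : V → ℝ) (s p : ℝ) (Ω : Set V) (u : V → ℝ) : Prop :=
  H.MemSobolev μ q s p u ∧
    ∃ φ : ℕ → V → ℝ, (∀ n, IsTestFunction Ω (φ n)) ∧
      Tendsto (fun n => H.sobolevNorm μ q s p (fun x => u x - φ n x)) atTop (𝓝 0)

/-- `u` is a weak solution of `(-Δ_{p,q})^s u = w |u|^{p-2} u` in `Ω`, `u = 0` outside `Ω`. -/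
structure HomogeneousGroup.IsWeakSolution (H : HomogeneousGroup V) [MeasurableSpace V]
    (μ : Measure V) (q : V → ℝ) (s p : ℝ) (Ω : Set V) (w u : V → ℝ) : Prop where
  mem : H.MemSobolevZero μ q s p Ω u
  eq_zero_outside : ∀ᵐ x ∂μ, x ∉ Ω → u x = 0
  weak_eq : ∀ v : V → ℝ, H.MemSobolevZero μ q s p Ω v →
    ∫ z : V × V, |u z.1 - u z.2| ^ (p - 2) * (u z.1 - u z.2) * (v z.1 - v z.2) /
        q (z.2⁻¹ * z.1) ^ (H.homDim + s * p) ∂(μ.prod μ)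
      = ∫ x in Ω, w x * |u x| ^ (p - 2) * u x * v x ∂μ

/-- The inner quasi-radius `r_{Ω,q} = sup {q x : x ∈ Ω}`, with the value `∞` if `q` is unbounded
on `Ω`. -/
def innerQuasiRadius (q : V → ℝ) (Ω : Set V) : ℝ≥0∞ :=
  ⨆ x ∈ Ω, ENNReal.ofReal (q x)

end HomGroup

end

namespace HomGroup

section Dilation

variable {V : Type*} [NormedAddCommGroup V] [NormedSpace ℝ V]

theorem dilation_one (A : V →L[ℝ] V) : dilation A 1 = 1 := by
  simp [dilation, NormedSpace.exp_zero]

variable [FiniteDimensional ℝ V]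

theorem dilation_mul_dilation (A : V →L[ℝ] V) {t r : ℝ} (ht : 0 < t) (hr : 0 < r) :
    dilation A t * dilation A r = dilation A (t * r) := by
  have : CompleteSpace V := FiniteDimensional.complete ℝ V
  let : NormedAlgebra ℚ (V →L[ℝ] V) := NormedAlgebra.restrictScalars ℚ ℝ _
  rw [dilation, dilation, dilation, Real.log_mul ht.ne' hr.ne', add_smul,
    NormedSpace.exp_add_of_commute]
  exact ((Commute.refl A).smul_left _).smul_right _

theorem dilation_apply_inv (A : V →L[ℝ] V) {t : ℝ} (ht : 0 < t) (x : V) :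
    dilation A t (dilation A t⁻¹ x) = x := by
  have := dilation_mul_dilation A ht (inv_pos.2 ht)
  rw [mul_inv_cancel₀ ht.ne', dilation_one] at this
  exact DFunLike.congr_fun this x

theorem continuousOn_dilation_apply (A : V →L[ℝ] V) (x : V) :
    ContinuousOn (fun t => dilation A t x) (Set.Ioi 0) := by
  have : CompleteSpace V := FiniteDimensional.complete ℝ V
  let : NormedAlgebra ℚ (V →L[ℝ] V) := NormedAlgebra.restrictScalars ℚ ℝ _
  have h : Continuous (NormedSpace.exp : (V →L[ℝ] V) → _) := NormedSpace.exp_continuous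
  have h2 : ContinuousOn (fun t => Real.log t • A) (Set.Ioi 0) :=
    (Real.continuousOn_log.mono fun t (ht : 0 < t) => ht.ne').smul continuousOn_const
  exact (h.comp_continuousOn h2).clm_apply continuousOn_const

theorem dilation_apply_of_mem_eigenspace (A : V →L[ℝ] V) {ν : ℝ} {x : V} {t : ℝ} (ht : 0 < t)
    (hx : x ∈ Module.End.eigenspace (A : V →ₗ[ℝ] V) ν) : dilation A t x = t ^ ν • x := by
  have : CompleteSpace V := FiniteDimensional.complete ℝ V
  have hx' : A x = ν • x := Module.End.mem_eigenspace_iff.1 hx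
  have hpow : ∀ n : ℕ, (((Real.log t) • A) ^ n) x = (Real.log t * ν) ^ n • x := by
    intro n
    induction n with
    | zero => simp
    | succ n ih =>
      rw [pow_succ', mul_apply_eq_comp, ih, map_smul]
      simp only [smul_apply, hx', smul_smul]
      ring_nf
  have h1 := (NormedSpace.exp_series_hasSum_exp' (𝕂 := ℝ) (Real.log t • A)).mapL
    (ContinuousLinearMap.apply ℝ V x)
  have h2 := (NormedSpace.exp_series_hasSum_exp' (𝕂 := ℝ) (Real.log t * ν)).smul_const x
  rw [Real.rpow_def_of_pos ht, Real.exp_eq_exp_ℝ]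
  refine h1.unique ?_
  convert h2 using 2 with n
  simp [hpow, smul_smul]

end Dilation

namespace HomogeneousGroup

variable {V : Type*} [NormedAddCommGroup V] [NormedSpace ℝ V] [FiniteDimensional ℝ V] [Group V]
variable (H : HomogeneousGroup V)

theorem exists_eigenbasis : ∃ (ι : Type) (_ : Fintype ι) (_ : DecidableEq ι)
    (b : Module.Basis ι ℝ V) (ν : ι → ℝ),
    ∀ i, b i ∈ Module.End.eigenspace (H.A : V →ₗ[ℝ] V) (ν i) := by
  classical
  have hint : DirectSum.IsInternal (fun ν : ℝ => Module.End.eigenspace (H.A : V →ₗ[ℝ] V) ν) :=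
    DirectSum.isInternal_submodule_of_iSupIndep_of_iSup_eq_top
      (Module.End.eigenspaces_iSupIndep _) H.diagonalizable
  let b := hint.collectedBasis fun ν => Module.finBasis ℝ _
  let : Fintype (Σ ν : ℝ, Fin (Module.finrank ℝ
    (Module.End.eigenspace (H.A : V →ₗ[ℝ] V) ν))) := FiniteDimensional.fintypeBasisIndex b
  exact ⟨_, inferInstance, inferInstance, b, fun i => i.1, fun i => hint.collectedBasis_mem _ i⟩

theorem det_dilation {t : ℝ} (ht : 0 < t) :
    LinearMap.det (dilation H.A t : V →ₗ[ℝ] V) = t ^ H.homDim := by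
  obtain ⟨ι, _, _, b, ν, hb⟩ := H.exists_eigenbasis
  have h1 : LinearMap.toMatrix b b (dilation H.A t : V →ₗ[ℝ] V)
      = Matrix.diagonal fun i => t ^ ν i := by
    ext i j
    rw [LinearMap.toMatrix_apply, ContinuousLinearMap.coe_coe,
      dilation_apply_of_mem_eigenspace _ ht (hb j)]
    by_cases h : i = j
    · subst h; simp
    · simp [h]
  have h2 : LinearMap.toMatrix b b (H.A : V →ₗ[ℝ] V) = Matrix.diagonal ν := by
    ext i j
    rw [LinearMap.toMatrix_apply, Module.End.mem_eigenspace_iff.1 (hb j)]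
    by_cases h : i = j
    · subst h; simp
    · simp [h]
  rw [← LinearMap.det_toMatrix b, h1, Matrix.det_diagonal, homDim,
    LinearMap.trace_eq_matrix_trace ℝ b, h2, Matrix.trace_diagonal, Real.rpow_sum_of_pos ht]

theorem tendsto_dilation_apply (x : V) :
    Tendsto (fun t => dilation H.A t x) (𝓝[>] 0) (𝓝 0) := by
  obtain ⟨ι, _, _, b, ν, hb⟩ := H.exists_eigenbasis
  have hν : ∀ i, 0 < ν i := fun i =>
    H.eigenvalue_pos _ (Module.End.hasEigenvalue_of_hasEigenvector ⟨hb i, b.ne_zero i⟩)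
  have key : Tendsto (fun t : ℝ => ∑ i, b.repr x i • t ^ ν i • b i) (𝓝[>] 0)
      (𝓝 (∑ i, b.repr x i • (0 : ℝ) ^ ν i • b i)) := by
    refine tendsto_finsetSum _ fun i _ => Tendsto.const_smul (Tendsto.smul_const ?_ _) _
    exact ((Real.continuousAt_rpow_const 0 (ν i) (Or.inr (hν i).le)).tendsto).mono_left
      nhdsWithin_le_nhds
  have h0 : ∑ i, b.repr x i • (0 : ℝ) ^ ν i • b i = 0 :=
    Finset.sum_eq_zero fun i _ => by simp [Real.zero_rpow (hν i).ne']
  rw [h0] at key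
  refine key.congr' ?_
  filter_upwards [self_mem_nhdsWithin] with t ht
  conv_rhs => rw [← b.sum_repr x]
  simp only [map_sum, map_smul]
  exact Finset.sum_congr rfl fun i _ => by rw [dilation_apply_of_mem_eigenspace _ ht (hb i)]

theorem isTopologicalGroup (H : HomogeneousGroup V) : IsTopologicalGroup V :=
  have := H.lieGroup
  topologicalGroup_of_lieGroup 𝓘(ℝ, V) ∞

theorem contDiff_mul (H : HomogeneousGroup V) : ContDiff ℝ ∞ fun z : V × V => z.1 * z.2 := by
  have := H.lieGroup
  have h := contMDiff_mul 𝓘(ℝ, V) ∞ (G := V)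
  rw [← modelWithCornersSelf_prod, chartedSpaceSelf_prod] at h
  exact h.contDiff

/-- The differential in `y` of the left translation `y ↦ x * y`. -/
noncomputable def leftDeriv (_H : HomogeneousGroup V) (x y : V) : V →L[ℝ] V :=
  fderiv ℝ (fun z => x * z) y

theorem hasFDerivAt_mul_left (x y : V) : HasFDerivAt (fun z => x * z) (H.leftDeriv x y) y := by
  have h : ContDiff ℝ ∞ fun z : V => x * z := H.contDiff_mul.comp (contDiff_const.prodMk contDiff_id)
  exact (h.differentiable (by simp) y).hasFDerivAt

theorem continuous_leftDeriv : Continuous fun z : V × V => H.leftDeriv z.1 z.2 := by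
  have h : ContDiff ℝ ∞ (Function.uncurry fun (z : V × V) (w : V) => z.1 * w) :=
    H.contDiff_mul.comp ((contDiff_fst.fst).prodMk contDiff_snd)
  exact (ContDiff.fderiv (m := ∞) (n := 0) h contDiff_snd
    (by simp)).continuous

theorem leftDeriv_dilation {t : ℝ} (ht : 0 < t) (x y : V) :
    (H.leftDeriv (dilation H.A t x) (dilation H.A t y)).comp (dilation H.A t)
      = (dilation H.A t).comp (H.leftDeriv x y) := by
  have h1 := (H.hasFDerivAt_mul_left (dilation H.A t x) (dilation H.A t y)).comp y
    (dilation H.A t).hasFDerivAt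
  have h2 := (dilation H.A t).hasFDerivAt.comp y (H.hasFDerivAt_mul_left x y)
  refine h1.unique ?_
  convert h2 using 1
  ext z
  exact (H.dilation_mul t ht x z).symm

theorem det_leftDeriv_dilation {t : ℝ} (ht : 0 < t) (x y : V) :
    (H.leftDeriv (dilation H.A t x) (dilation H.A t y)).det = (H.leftDeriv x y).det := by
  have h := congrArg ContinuousLinearMap.det (H.leftDeriv_dilation ht x y)
  have h0 : LinearMap.det (dilation H.A t : V →ₗ[ℝ] V) ≠ 0 := by
    rw [H.det_dilation ht]; positivity
  simp only [ContinuousLinearMap.det, ContinuousLinearMap.toLinearMap_comp, LinearMap.det_comp] at h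
  rw [mul_comm] at h
  exact mul_left_cancel₀ h0 h

/-- Left translations preserve the volume: their Jacobian is invariant under dilations, hence
equal to its value at the origin. -/
theorem det_leftDeriv (x y : V) : (H.leftDeriv x y).det = 1 := by
  have h00 : H.leftDeriv 0 0 = ContinuousLinearMap.id ℝ V := by
    refine (H.hasFDerivAt_mul_left 0 0).unique ?_
    convert hasFDerivAt_id (𝕜 := ℝ) (0 : V) using 1
    ext z
    rw [← H.one_eq_zero, one_mul]; rfl
  have hc : Continuous fun z : V × V => (H.leftDeriv z.1 z.2).det :=
    ContinuousLinearMap.continuous_det.comp H.continuous_leftDeriv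
  have hlim : Tendsto (fun t => (H.leftDeriv (dilation H.A t x) (dilation H.A t y)).det) (𝓝[>] 0)
      (𝓝 ((H.leftDeriv 0 0).det)) :=
    (hc.tendsto (0, 0)).comp
      ((H.tendsto_dilation_apply x).prodMk_nhds (H.tendsto_dilation_apply y))
  have hcst : Tendsto (fun t => (H.leftDeriv (dilation H.A t x) (dilation H.A t y)).det) (𝓝[>] 0)
      (𝓝 ((H.leftDeriv x y).det)) := by
    refine tendsto_const_nhds.congr' ?_
    filter_upwards [self_mem_nhdsWithin] with t ht
    exact (H.det_leftDeriv_dilation ht x y).symm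
  rw [tendsto_nhds_unique hcst hlim, h00]
  simp [ContinuousLinearMap.det]

variable [MeasurableSpace V] [BorelSpace V]

theorem isMulLeftInvariant_addHaar (H : HomogeneousGroup V) (lam : Measure V) [lam.IsAddHaarMeasure] :
    lam.IsMulLeftInvariant := by
  have := H.isTopologicalGroup
  refine ⟨fun g => Measure.ext fun S hS => ?_⟩
  rw [Measure.map_apply (measurable_const_mul g) hS]
  have h := lintegral_abs_det_fderiv_eq_addHaar_image lam
    (measurable_const_mul g hS) (f := fun z => g * z) (f' := fun y => H.leftDeriv g y)
    (fun y _ => (H.hasFDerivAt_mul_left g y).hasFDerivWithinAt) (mul_right_injective g).injOn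
  simp only [det_leftDeriv, abs_one, ENNReal.ofReal_one, lintegral_one, Measure.restrict_apply
    MeasurableSet.univ, Set.univ_inter] at h
  rw [h, Set.image_preimage_eq _ (mul_left_surjective g)]

theorem measure_image_dilation (μ : Measure V) [μ.IsHaarMeasure] {t : ℝ} (ht : 0 < t) (S : Set V) :
    μ (dilation H.A t '' S) = ENNReal.ofReal (t ^ H.homDim) * μ S := by
  have := H.isTopologicalGroup
  have := H.isMulLeftInvariant_addHaar (Measure.addHaar (G := V))
  have : ProperSpace V := FiniteDimensional.proper ℝ V
  have : (Measure.addHaar (G := V)).IsHaarMeasure :=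
    Measure.isHaarMeasure_of_isCompact_nonempty_interior _ (Metric.closedBall (0 : V) 1)
      (isCompact_closedBall _ _) ⟨0, by simp [mem_interior_iff_mem_nhds, Metric.closedBall_mem_nhds]⟩
      (Metric.measure_closedBall_pos _ _ one_pos).ne' (isCompact_closedBall _ _).measure_lt_top.ne
  rw [Measure.isMulLeftInvariant_eq_smul μ (Measure.addHaar (G := V))]
  simp only [Measure.smul_apply, Measure.addHaar_image_continuousLinearMap, H.det_dilation ht,
    abs_of_nonneg (Real.rpow_nonneg ht.le _)]
  exact (mul_smul_comm _ _ _).symm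

end HomogeneousGroup

end HomGroup

noncomputable section

namespace HomGroup

/-- Optimisation of `T ^ σ * D + T ^ (σ - 1) * E` over `T > 0`. -/
theorem le_two_mul_rpow_mul_rpow {a D E : ℝ≥0∞} {σ : ℝ} (hσ : σ ∈ Set.Ioo (0 : ℝ) 1) (hE0 : E ≠ 0)
    (hE : E ≠ ⊤)
    (h : ∀ T : ℝ, 0 < T → a ≤ ENNReal.ofReal (T ^ σ) * D + ENNReal.ofReal (T ^ (σ - 1)) * E) :
    a ≤ 2 * (D ^ (1 - σ) * E ^ σ) := by
  have h1σ : 0 < 1 - σ := sub_pos.2 hσ.2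
  rcases eq_or_ne D ⊤ with rfl | hD
  · rw [ENNReal.top_rpow_of_pos h1σ, ENNReal.top_mul, ENNReal.mul_top]
    · exact le_top
    · simp
    · simp [hE0, hE]
  rcases eq_or_ne D 0 with rfl | hD0
  · have hlim : Tendsto (fun T : ℝ => ENNReal.ofReal (T ^ (σ - 1)) * E) atTop (𝓝 0) := by
      have h1 := ENNReal.tendsto_ofReal (tendsto_rpow_neg_atTop h1σ)
      have h2 := ENNReal.Tendsto.mul_const h1 (b := E) (Or.inr hE)
      simpa using h2
    refine (ge_of_tendsto hlim ?_).trans zero_le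
    filter_upwards [eventually_gt_atTop 0] with T hT
    simpa using h T hT
  · have hd := ENNReal.toReal_pos hD0 hD
    have he := ENNReal.toReal_pos hE0 hE
    rw [← ENNReal.ofReal_toReal hD, ← ENNReal.ofReal_toReal hE] at h ⊢
    set d := D.toReal
    set e := E.toReal
    refine (h (e / d) (by positivity)).trans (le_of_eq ?_)
    rw [ENNReal.ofReal_rpow_of_pos hd, ENNReal.ofReal_rpow_of_pos he,
      ← ENNReal.ofReal_mul (by positivity), ← ENNReal.ofReal_mul (by positivity),
      ← ENNReal.ofReal_mul (by positivity), two_mul]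
    have e1 : (e / d) ^ σ * d = d ^ (1 - σ) * e ^ σ := by
      rw [Real.div_rpow he.le hd.le, Real.rpow_sub hd, Real.rpow_one]; ring
    have e2 : (e / d) ^ (σ - 1) * e = d ^ (1 - σ) * e ^ σ := by
      rw [Real.rpow_sub (by positivity), Real.rpow_one, Real.div_rpow he.le hd.le, Real.rpow_sub hd,
        Real.rpow_one]
      field_simp
    rw [e1, e2]

namespace HomogeneousGroup

variable {V : Type*} [NormedAddCommGroup V] [NormedSpace ℝ V] [FiniteDimensional ℝ V] [Group V]
variable {H : HomogeneousGroup V} {q : V → ℝ}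

namespace IsQuasiNorm

theorem image_dilation_sublevel (hq : H.IsQuasiNorm q) {R : ℝ} (hR : 0 < R) (r : ℝ) :
    dilation H.A R '' {x | q x ≤ r} = {x | q x ≤ R * r} := by
  ext x
  constructor
  · rintro ⟨y, hy, rfl⟩
    simp only [Set.mem_ofPred_eq] at hy ⊢
    rw [hq.homogeneous R hR]; gcongr
  · intro hx
    refine ⟨dilation H.A R⁻¹ x, ?_, dilation_apply_inv _ hR x⟩
    simp only [Set.mem_ofPred_eq] at hx ⊢
    rw [hq.homogeneous _ (inv_pos.2 hR), inv_mul_le_iff₀ hR]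
    exact hx

theorem exists_sublevel_subset_closedBall (hq : H.IsQuasiNorm q) :
    ∃ m : ℝ, 0 < m ∧ {x | q x ≤ m} ⊆ Metric.closedBall 0 1 := by
  have : ProperSpace V := FiniteDimensional.proper ℝ V
  obtain ⟨m, hm, hm'⟩ : ∃ m : ℝ, 0 < m ∧ ∀ x ∈ Metric.sphere (0 : V) 1, m ≤ q x := by
    rcases (Metric.sphere (0 : V) 1).eq_empty_or_nonempty with h | h
    · exact ⟨1, one_pos, by simp [h]⟩
    · obtain ⟨x, hx, hmin⟩ := (isCompact_sphere (0 : V) 1).exists_isMinOn h hq.continuous.continuousOn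
      refine ⟨q x, (hq.nonneg x).lt_of_ne' fun h0 => ?_, hmin⟩
      rw [(hq.eq_zero_iff x).1 h0] at hx
      simp at hx
  refine ⟨m / 2, half_pos hm, fun x hx => ?_⟩
  simp only [Set.mem_ofPred_eq] at hx
  rw [mem_closedBall_zero_iff]
  by_contra! hx1
  have hlim : Tendsto (fun t => ‖dilation H.A t x‖) (𝓝[>] 0) (𝓝 0) := by
    simpa using (H.tendsto_dilation_apply x).norm
  obtain ⟨t₀, ht₀, ht₀1, ht₀x⟩ : ∃ t : ℝ, 0 < t ∧ t < 1 ∧ ‖dilation H.A t x‖ < 1 := by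
    have h1 : ∀ᶠ t : ℝ in 𝓝[>] 0, t < 1 := nhdsWithin_le_nhds (eventually_lt_nhds one_pos)
    obtain ⟨t, h⟩ := ((hlim.eventually (eventually_lt_nhds one_pos)).and
      (h1.and self_mem_nhdsWithin)).exists
    exact ⟨t, h.2.2, h.2.1, h.1⟩
  have hcont : ContinuousOn (fun t => ‖dilation H.A t x‖) (Set.Icc t₀ 1) :=
    ((continuousOn_dilation_apply H.A x).mono fun t ht => ht₀.trans_le ht.1).norm
  obtain ⟨t, ht, htx⟩ := intermediate_value_Icc ht₀1.le hcont
    (show (1 : ℝ) ∈ Set.Icc _ _ from ⟨ht₀x.le, by simpa [dilation_one] using hx1.le⟩)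
  have h1 := hm' (dilation H.A t x) (by simpa using htx)
  rw [hq.homogeneous t (ht₀.trans_le ht.1)] at h1
  have : t * q x ≤ 1 * q x := mul_le_mul_of_nonneg_right ht.2 (hq.nonneg x)
  linarith

variable [MeasurableSpace V] (μ : Measure V) [μ.IsHaarMeasure]

theorem measure_sublevel_one_ne_zero (hq : H.IsQuasiNorm q) : μ {x | q x ≤ 1} ≠ 0 := by
  have hopen : IsOpen {x | q x < 1} := isOpen_lt hq.continuous continuous_const
  have hne : ({x | q x < 1} : Set V).Nonempty :=
    ⟨0, by simp [(hq.eq_zero_iff 0).2 rfl]⟩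
  exact ((hopen.measure_pos μ hne).trans_le (measure_mono fun x (hx : q x < 1) => hx.le)).ne'

variable [BorelSpace V]

theorem measure_sublevel (hq : H.IsQuasiNorm q) {R : ℝ} (hR : 0 < R) :
    μ {x | q x ≤ R} = ENNReal.ofReal (R ^ H.homDim) * μ {x | q x ≤ 1} := by
  rw [← H.measure_image_dilation μ hR, hq.image_dilation_sublevel hR, mul_one]

theorem measure_sublevel_one_ne_top (hq : H.IsQuasiNorm q) : μ {x | q x ≤ 1} ≠ ⊤ := by
  have : ProperSpace V := FiniteDimensional.proper ℝ V
  obtain ⟨m, hm, hsub⟩ := hq.exists_sublevel_subset_closedBall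
  have h1 : μ {x | q x ≤ m} < ⊤ :=
    (measure_mono hsub).trans_lt (isCompact_closedBall (0 : V) 1).measure_lt_top
  rw [hq.measure_sublevel μ hm] at h1
  intro h
  rw [h, ENNReal.mul_top (by simpa using Real.rpow_pos_of_pos hm _)] at h1
  exact lt_irrefl _ h1

theorem measure_sublevel_le (hq : H.IsQuasiNorm q) (hQ : 0 < H.homDim) (r : ℝ≥0∞) :
    μ {x | ENNReal.ofReal (q x) ≤ r} ≤ r ^ H.homDim * μ {x | q x ≤ 1} := by
  rcases eq_or_ne r ⊤ with rfl | hr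
  · rw [ENNReal.top_rpow_of_pos hQ, ENNReal.top_mul (hq.measure_sublevel_one_ne_zero μ)]
    exact le_top
  have key : ∀ ε : ℝ, 0 < ε → μ {x | ENNReal.ofReal (q x) ≤ r} ≤
      (r + ENNReal.ofReal ε) ^ H.homDim * μ {x | q x ≤ 1} := by
    intro ε hε
    have hpos : 0 < r.toReal + ε := by positivity
    have h := hq.measure_sublevel μ hpos
    rw [← ENNReal.ofReal_rpow_of_pos hpos, ENNReal.ofReal_add ENNReal.toReal_nonneg hε.le,
      ENNReal.ofReal_toReal hr] at h
    rw [← h]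
    refine measure_mono fun x hx => ?_
    have := (ENNReal.ofReal_le_iff_le_toReal hr).1 hx
    simp only [Set.mem_ofPred_eq]
    linarith
  have hlim : Tendsto (fun ε : ℝ => (r + ENNReal.ofReal ε) ^ H.homDim * μ {x | q x ≤ 1}) (𝓝[>] 0)
      (𝓝 (r ^ H.homDim * μ {x | q x ≤ 1})) := by
    refine ENNReal.Tendsto.mul_const ?_ (Or.inr (hq.measure_sublevel_one_ne_top μ))
    refine ((ENNReal.continuous_rpow_const (y := H.homDim)).tendsto r).comp ?_
    have : Tendsto (fun ε : ℝ => r + ENNReal.ofReal ε) (𝓝 0) (𝓝 (r + ENNReal.ofReal 0)) :=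
      tendsto_const_nhds.add (ENNReal.tendsto_ofReal tendsto_id)
    simp only [ENNReal.ofReal_zero, add_zero] at this
    exact this.mono_left nhdsWithin_le_nhds
  refine ge_of_tendsto hlim ?_
  filter_upwards [self_mem_nhdsWithin] with ε hε using key ε hε

theorem measure_ball (hq : H.IsQuasiNorm q) (x : V) {R : ℝ} (hR : 0 < R) :
    μ {y | q (y⁻¹ * x) ≤ R} = ENNReal.ofReal (R ^ H.homDim) * μ {x | q x ≤ 1} := by
  have := H.isTopologicalGroup
  rw [← hq.measure_sublevel μ hR, ← measure_preimage_mul μ x⁻¹ {x | q x ≤ R}]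
  congr 1
  ext y
  simp only [Set.mem_ofPred_eq, Set.preimage_ofPred_eq]
  rw [← hq.inv (x⁻¹ * y), mul_inv_rev, inv_inv]

theorem measurable_kernel (hq : H.IsQuasiNorm q) (a : ℝ) :
    Measurable fun z : V × V => q (z.2⁻¹ * z.1) ^ a := by
  have := H.isTopologicalGroup
  have h : Measurable fun z : V × V => q (z.2⁻¹ * z.1) :=
    (hq.continuous.comp (continuous_snd.inv.mul continuous_fst)).measurable
  exact h.pow_const a

/-- The integral over a quasi-ball of the `p`-th power of the increments of `f`. -/
theorem rpow_enorm_mul_measure_ball_le (hq : H.IsQuasiNorm q) {s p σ : ℝ} (hp : 1 < p)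
    (hσ : σ ∈ Set.Ioo (0 : ℝ) 1) (hb : 0 ≤ H.homDim + s * p) {f : V → ℝ} (hf : Measurable f)
    (x : V) {R : ℝ} (hR : 0 < R) :
    ‖f x‖ₑ ^ p * (ENNReal.ofReal (R ^ H.homDim) * μ {x | q x ≤ 1}) ≤
      2 ^ (p - 1) * (ENNReal.ofReal (R ^ (H.homDim + s * p)) *
          (∫⁻ y, ENNReal.ofReal (|f x - f y| ^ p / q (y⁻¹ * x) ^ (H.homDim + s * p)) ∂μ)
        + (∫⁻ y, ‖f y‖ₑ ^ (p / (1 - σ)) ∂μ) ^ (1 - σ) *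
          (ENNReal.ofReal (R ^ H.homDim) * μ {x | q x ≤ 1}) ^ σ) := by
  have := H.isTopologicalGroup
  have hp0 : 0 < p := by linarith
  have h1σ : 0 < 1 - σ := sub_pos.2 hσ.2
  set B : Set V := {y | q (y⁻¹ * x) ≤ R} with hB
  have hBm : MeasurableSet B :=
    (isClosed_le (hq.continuous.comp (continuous_inv.mul continuous_const))
      continuous_const).measurableSet
  rw [← hq.measure_ball μ x hR]
  have h1 : ∫⁻ y in B, ‖f x - f y‖ₑ ^ p ∂μ ≤ ENNReal.ofReal (R ^ (H.homDim + s * p)) *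
      (∫⁻ y, ENNReal.ofReal (|f x - f y| ^ p / q (y⁻¹ * x) ^ (H.homDim + s * p)) ∂μ) := by
    rw [← lintegral_const_mul' _ _ ENNReal.ofReal_ne_top]
    refine (setLIntegral_mono' hBm fun y hy => ?_).trans (setLIntegral_le_lintegral _ _)
    rw [Real.enorm_eq_ofReal_abs, ENNReal.ofReal_rpow_of_nonneg (abs_nonneg _) hp0.le,
      ← ENNReal.ofReal_mul (by positivity)]
    refine ENNReal.ofReal_le_ofReal ?_
    rcases (hq.nonneg (y⁻¹ * x)).eq_or_lt' with h0 | h0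
    · have h0' := (hq.eq_zero_iff _).1 h0
      rw [← H.one_eq_zero, inv_mul_eq_one] at h0'
      simp [h0', Real.zero_rpow hp0.ne']
    · rw [← mul_div_assoc, le_div_iff₀ (by positivity), mul_comm]
      gcongr
      exact hy
  have h2 : ∫⁻ y in B, ‖f y‖ₑ ^ p ∂μ ≤
      (∫⁻ y, ‖f y‖ₑ ^ (p / (1 - σ)) ∂μ) ^ (1 - σ) * μ B ^ σ := by
    have hm : Measurable fun y => ‖f y‖ₑ ^ (p / (1 - σ)) := hf.enorm.pow_const _
    have h := ENNReal.lintegral_mul_norm_pow_le (μ := μ.restrict B) (f := fun y => ‖f y‖ₑ ^ (p / (1 - σ)))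
      (g := fun _ => 1) hm.aemeasurable aemeasurable_const h1σ.le hσ.1.le (by ring)
    simp only [ENNReal.one_rpow, mul_one, ← ENNReal.rpow_mul, div_mul_cancel₀ _ h1σ.ne',
      lintegral_one, Measure.restrict_apply MeasurableSet.univ, Set.univ_inter] at h
    refine h.trans ?_
    gcongr
    exact Measure.restrict_le_self
  calc ‖f x‖ₑ ^ p * μ B = ∫⁻ y in B, ‖f x‖ₑ ^ p ∂μ := by rw [setLIntegral_const]
    _ ≤ ∫⁻ y in B, 2 ^ (p - 1) * (‖f x - f y‖ₑ ^ p + ‖f y‖ₑ ^ p) ∂μ := by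
        refine lintegral_mono fun y => ?_
        refine le_trans ?_ (ENNReal.rpow_add_le_mul_rpow_add_rpow _ _ hp.le)
        gcongr
        calc ‖f x‖ₑ = ‖(f x - f y) + f y‖ₑ := by rw [sub_add_cancel]
          _ ≤ _ := enorm_add_le _ _
    _ = 2 ^ (p - 1) * (∫⁻ y in B, ‖f x - f y‖ₑ ^ p ∂μ + ∫⁻ y in B, ‖f y‖ₑ ^ p ∂μ) := by
        rw [lintegral_const_mul' _ _ (ENNReal.rpow_ne_top_of_nonneg (by linarith) (by simp)),
          lintegral_add_right _ (hf.enorm.pow_const _)]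
    _ ≤ _ := by gcongr

/-- The fractional Sobolev inequality for measurable functions of class `L^{p/(1-σ)}`. -/
theorem exists_sobolev_of_ne_top (hq : H.IsQuasiNorm q) {s p σ : ℝ} (hp : 1 < p)
    (hσ : σ ∈ Set.Ioo (0 : ℝ) 1) (hQ : 0 < H.homDim) (hσQ : σ * H.homDim = s * p) :
    ∃ K : ℝ≥0∞, K ≠ ⊤ ∧ ∀ f : V → ℝ, Measurable f → ∫⁻ y, ‖f y‖ₑ ^ (p / (1 - σ)) ∂μ ≠ ⊤ →
      (∫⁻ y, ‖f y‖ₑ ^ (p / (1 - σ)) ∂μ) ^ (1 - σ) ≤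
        K * ∫⁻ z : V × V, ENNReal.ofReal (|f z.1 - f z.2| ^ p /
          q (z.2⁻¹ * z.1) ^ (H.homDim + s * p)) ∂(μ.prod μ) := by
  have hp0 : 0 < p := by linarith
  have h1σ : 0 < 1 - σ := sub_pos.2 hσ.2
  set M := μ {x | q x ≤ 1} with hM
  have hMt : M ≠ ⊤ := hq.measure_sublevel_one_ne_top μ
  have hM0 : M ≠ 0 := hq.measure_sublevel_one_ne_zero μ
  set L : ℝ≥0∞ := 2 ^ (p - 1) / M with hL
  have h2t : (2 : ℝ≥0∞) ^ (p - 1) ≠ ⊤ := ENNReal.rpow_ne_top_of_nonneg (by linarith) (by simp)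
  have h20 : (2 : ℝ≥0∞) ^ (p - 1) ≠ 0 := (ENNReal.rpow_pos (by simp) (by simp)).ne'
  have hLt : L ≠ ⊤ := ENNReal.div_ne_top h2t hM0
  have hL0 : L ≠ 0 := ENNReal.div_ne_zero.2 ⟨h20, hMt⟩
  have hLM : L * M = 2 ^ (p - 1) := ENNReal.div_mul_cancel hM0 hMt
  have hMσt : M ^ σ ≠ ⊤ := ENNReal.rpow_ne_top_of_nonneg hσ.1.le hMt
  have hMσ0 : M ^ σ ≠ 0 := (ENNReal.rpow_pos (pos_iff_ne_zero.2 hM0) hMt).ne'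
  set k : ℝ≥0∞ := 2 * (L ^ (1 - σ) * (L * M ^ σ) ^ σ) with hk
  have hkt : k ≠ ⊤ := ENNReal.mul_ne_top (by simp) (ENNReal.mul_ne_top
    (ENNReal.rpow_ne_top_of_nonneg h1σ.le hLt)
    (ENNReal.rpow_ne_top_of_nonneg hσ.1.le (ENNReal.mul_ne_top hLt hMσt)))
  refine ⟨k ^ (1 - σ)⁻¹, ENNReal.rpow_ne_top_of_nonneg (by positivity) hkt, fun f hf hUt => ?_⟩
  set U := ∫⁻ y, ‖f y‖ₑ ^ (p / (1 - σ)) ∂μ with hU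
  rcases eq_or_ne U 0 with hU0 | hU0
  · rw [hU0, ENNReal.zero_rpow_of_pos h1σ]; exact zero_le
  set D : V → ℝ≥0∞ := fun x =>
    ∫⁻ y, ENNReal.ofReal (|f x - f y| ^ p / q (y⁻¹ * x) ^ (H.homDim + s * p)) ∂μ with hD
  have hU1t : U ^ (1 - σ) ≠ ⊤ := ENNReal.rpow_ne_top_of_nonneg h1σ.le hUt
  have hU10 : U ^ (1 - σ) ≠ 0 := (ENNReal.rpow_pos (pos_iff_ne_zero.2 hU0) hUt).ne'
  have hpt : ∀ x, ‖f x‖ₑ ^ p ≤ k * (D x ^ (1 - σ) * (U ^ (1 - σ)) ^ σ) := by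
    intro x
    have hopt := le_two_mul_rpow_mul_rpow (a := ‖f x‖ₑ ^ p) (D := L * D x)
      (E := L * M ^ σ * U ^ (1 - σ)) hσ (mul_ne_zero (mul_ne_zero hL0 hMσ0) hU10)
      (ENNReal.mul_ne_top (ENNReal.mul_ne_top hLt hMσt) hU1t) ?_
    · refine hopt.trans (le_of_eq ?_)
      rw [ENNReal.mul_rpow_of_nonneg _ _ h1σ.le, ENNReal.mul_rpow_of_nonneg _ (U ^ (1 - σ)) hσ.1.le]
      ring
    · intro T hT
      have hR : 0 < T ^ (H.homDim)⁻¹ := by positivity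
      have h := hq.rpow_enorm_mul_measure_ball_le μ hp hσ (s := s)
        (by rw [← hσQ]; nlinarith [hσ.1]) hf x hR
      have e1 : (T ^ (H.homDim)⁻¹) ^ H.homDim = T := Real.rpow_inv_rpow hT.le hQ.ne'
      have e2 : (T ^ (H.homDim)⁻¹) ^ (H.homDim + s * p) = T * T ^ σ := by
        rw [Real.rpow_add hR, e1, ← hσQ, mul_comm σ, Real.rpow_mul hR.le, e1]
      have hTσ : ENNReal.ofReal T ^ σ = ENNReal.ofReal T * ENNReal.ofReal (T ^ (σ - 1)) := by
        rw [← ENNReal.ofReal_mul hT.le, ENNReal.ofReal_rpow_of_pos hT, Real.rpow_sub hT,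
          Real.rpow_one, mul_div_cancel₀ _ hT.ne']
      rw [e1, e2, ENNReal.mul_rpow_of_nonneg _ _ hσ.1.le, hTσ, ENNReal.ofReal_mul hT.le,
        ← hLM] at h
      have hT0 : ENNReal.ofReal T * M ≠ 0 := mul_ne_zero (by simpa using hT) hM0
      have hTt : ENNReal.ofReal T * M ≠ ⊤ := ENNReal.mul_ne_top (by simp) hMt
      rw [← ENNReal.mul_le_mul_iff_left hT0 hTt]
      refine h.trans (le_of_eq ?_)
      ring
  have hpt2 : ∀ x, ‖f x‖ₑ ^ (p / (1 - σ)) ≤ k ^ (1 - σ)⁻¹ * U ^ σ * D x := by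
    intro x
    clear_value k
    have h := ENNReal.rpow_le_rpow (hpt x) (inv_nonneg.2 h1σ.le)
    rw [← ENNReal.rpow_mul, ENNReal.mul_rpow_of_nonneg _ _ (inv_nonneg.2 h1σ.le),
      ENNReal.mul_rpow_of_nonneg _ _ (inv_nonneg.2 h1σ.le), ENNReal.rpow_rpow_inv h1σ.ne',
      ← ENNReal.rpow_mul, ← ENNReal.rpow_mul,
      show (1 - σ) * (σ * (1 - σ)⁻¹) = σ by field_simp, ← div_eq_mul_inv] at h
    refine h.trans (le_of_eq ?_)
    ring
  have hint : ∫⁻ x, D x ∂μ = ∫⁻ z : V × V, ENNReal.ofReal (|f z.1 - f z.2| ^ p /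
      q (z.2⁻¹ * z.1) ^ (H.homDim + s * p)) ∂(μ.prod μ) := by
    have := H.isTopologicalGroup
    rw [lintegral_prod]
    have hm : Measurable fun z : V × V => |f z.1 - f z.2| ^ p :=
      ((hf.comp measurable_fst).sub (hf.comp measurable_snd)).abs.pow_const p
    exact (hm.div (hq.measurable_kernel _)).ennreal_ofReal.aemeasurable
  have hUσt : U ^ σ ≠ ⊤ := ENNReal.rpow_ne_top_of_nonneg hσ.1.le hUt
  have hUσ0 : U ^ σ ≠ 0 := (ENNReal.rpow_pos (pos_iff_ne_zero.2 hU0) hUt).ne'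
  have hfin : U ≤ k ^ (1 - σ)⁻¹ * U ^ σ * ∫⁻ x, D x ∂μ := by
    rw [← lintegral_const_mul' _ _ (ENNReal.mul_ne_top
      (ENNReal.rpow_ne_top_of_nonneg (by positivity) hkt) hUσt)]
    exact lintegral_mono hpt2
  rw [← hint, ← ENNReal.mul_le_mul_iff_left hUσ0 hUσt, ← ENNReal.rpow_add _ _ hU0 hUt,
    sub_add_cancel, ENNReal.rpow_one]
  refine hfin.trans (le_of_eq ?_)
  ring

end IsQuasiNorm

end HomogeneousGroup

end HomGroup

end

noncomputable section

namespace HomGroup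

namespace HomogeneousGroup

variable {V : Type*} [NormedAddCommGroup V] [NormedSpace ℝ V] [FiniteDimensional ℝ V] [Group V]
variable {H : HomogeneousGroup V} {q : V → ℝ}
/-- The increments of `f`, weighted so that their `L^p` norm is the Gagliardo seminorm. -/
def weightedIncrement (H : HomogeneousGroup V) (q : V → ℝ) (s p : ℝ) (f : V → ℝ) (z : V × V) : ℝ :=
  (f z.1 - f z.2) / q (z.2⁻¹ * z.1) ^ ((H.homDim + s * p) / p)

namespace IsQuasiNorm

theorem abs_weightedIncrement_rpow (hq : H.IsQuasiNorm q) {s p : ℝ} (hp : 0 < p)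
    (f : V → ℝ) (z : V × V) :
    |H.weightedIncrement q s p f z| ^ p =
      |f z.1 - f z.2| ^ p / q (z.2⁻¹ * z.1) ^ (H.homDim + s * p) := by
  have h0 := hq.nonneg (z.2⁻¹ * z.1)
  rw [weightedIncrement, abs_div, Real.div_rpow (abs_nonneg _) (abs_nonneg _),
    abs_of_nonneg (Real.rpow_nonneg h0 _), ← Real.rpow_mul h0, div_mul_cancel₀ _ hp.ne']

variable [MeasurableSpace V]

theorem gagliardo_eq_eLpNorm (hq : H.IsQuasiNorm q) (μ : Measure V) {s p : ℝ} (hp : 0 < p)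
    (f : V → ℝ) :
    H.gagliardo μ q s p f =
      eLpNorm (H.weightedIncrement q s p f) (ENNReal.ofReal p) (μ.prod μ) := by
  rw [eLpNorm_eq_lintegral_rpow_enorm_toReal (by simpa using hp) (by simp), gagliardo,
    ENNReal.toReal_ofReal hp.le]
  congr 1
  refine lintegral_congr fun z => ?_
  rw [Real.enorm_eq_ofReal_abs, ENNReal.ofReal_rpow_of_nonneg (abs_nonneg _) hp.le,
    hq.abs_weightedIncrement_rpow hp]

variable [BorelSpace V] (μ : Measure V)

theorem aestronglyMeasurable_weightedIncrement (hq : H.IsQuasiNorm q) {s p : ℝ} {f : V → ℝ}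
    (hf : AEStronglyMeasurable f μ) :
    AEStronglyMeasurable (H.weightedIncrement q s p f) (μ.prod μ) := by
  have h1 : AEMeasurable (fun z : V × V => f z.1 - f z.2) (μ.prod μ) :=
    (hf.comp_fst.sub hf.comp_snd).aemeasurable
  exact (h1.div (hq.measurable_kernel _).aemeasurable).aestronglyMeasurable

/-- A weak solution tested against itself. -/
theorem gagliardo_rpow_le_of_isWeakSolution (hq : H.IsQuasiNorm q) {s p : ℝ} (hp : 0 < p)
    {Ω : Set V} {w u : V → ℝ} (hu : H.IsWeakSolution μ q s p Ω w u) :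
    H.gagliardo μ q s p u ^ p ≤ ∫⁻ x in Ω, ‖w x‖ₑ * ‖u x‖ₑ ^ p ∂μ := by
  have hmul : ∀ a : ℝ, |a| ^ (p - 2) * a * a = |a| ^ p := by
    intro a
    rcases eq_or_ne a 0 with rfl | ha
    · simp [Real.zero_rpow hp.ne']
    · rw [mul_assoc, ← abs_mul_abs_self a, ← pow_two, ← Real.rpow_natCast,
        ← Real.rpow_add (abs_pos.2 ha)]
      norm_num
  have hint : Integrable (fun z : V × V => |u z.1 - u z.2| ^ p /
      q (z.2⁻¹ * z.1) ^ (H.homDim + s * p)) (μ.prod μ) := by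
    have h2 : MemLp (H.weightedIncrement q s p u) (ENNReal.ofReal p) (μ.prod μ) :=
      ⟨hq.aestronglyMeasurable_weightedIncrement μ hu.mem.1.1.aestronglyMeasurable, by
        rw [← hq.gagliardo_eq_eLpNorm μ hp]; exact hu.mem.1.2⟩
    have h3 := h2.integrable_norm_rpow (by simpa using hp) (by simp)
    simpa only [ENNReal.toReal_ofReal hp.le, Real.norm_eq_abs,
      hq.abs_weightedIncrement_rpow hp] using h3
  have heq := hu.weak_eq u hu.mem
  simp only [hmul] at heq
  have hw : ∀ x, w x * |u x| ^ (p - 2) * u x * u x = w x * |u x| ^ p := fun x => by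
    rw [← hmul]; ring
  simp only [hw] at heq
  rw [gagliardo, ← ENNReal.rpow_mul, one_div_mul_cancel hp.ne', ENNReal.rpow_one,
    ← ofReal_integral_eq_lintegral_ofReal hint (Eventually.of_forall fun z =>
      div_nonneg (Real.rpow_nonneg (abs_nonneg _) _) (Real.rpow_nonneg (hq.nonneg _) _)), heq]
  refine (ENNReal.ofReal_le_ofReal (le_abs_self _)).trans ?_
  rw [← Real.enorm_eq_ofReal_abs]
  refine (enorm_integral_le_lintegral_enorm _).trans (le_of_eq (lintegral_congr fun x => ?_))
  rw [enorm_mul, Real.enorm_rpow_of_nonneg (abs_nonneg _) hp.le, Real.enorm_abs]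

variable [μ.IsHaarMeasure]

/-- The fractional Sobolev inequality in `W_0^{s,p,q}(Ω)`. -/
theorem exists_sobolev (hq : H.IsQuasiNorm q) {s p σ : ℝ} (hp : 1 < p)
    (hσ : σ ∈ Set.Ioo (0 : ℝ) 1) (hQ : 0 < H.homDim) (hσQ : σ * H.homDim = s * p) :
    ∃ K : ℝ≥0∞, K ≠ ⊤ ∧ ∀ (Ω : Set V) (u : V → ℝ), H.MemSobolevZero μ q s p Ω u →
      eLpNorm u (ENNReal.ofReal (p / (1 - σ))) μ ≤ K * H.gagliardo μ q s p u := by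
  have hp0 : 0 < p := by linarith
  have h1σ : 0 < 1 - σ := sub_pos.2 hσ.2
  have hP : 0 < p / (1 - σ) := by positivity
  obtain ⟨K, hK, hsob⟩ := hq.exists_sobolev_of_ne_top μ hp hσ hQ hσQ
  have hK' : K ^ (1 / p) ≠ ⊤ := ENNReal.rpow_ne_top_of_nonneg (by positivity) hK
  refine ⟨K ^ (1 / p), hK', fun Ω u hu => ?_⟩
  have htest : ∀ f, IsTestFunction Ω f →
      eLpNorm f (ENNReal.ofReal (p / (1 - σ))) μ ≤ K ^ (1 / p) * H.gagliardo μ q s p f := by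
    intro f hf
    have hP0 : ENNReal.ofReal (p / (1 - σ)) ≠ 0 := by simpa using hP
    have hfin := (hf.1.continuous.memLp_of_hasCompactSupport (μ := μ)
      (p := ENNReal.ofReal (p / (1 - σ))) hf.2.1).eLpNorm_lt_top
    rw [eLpNorm_lt_top_iff_lintegral_rpow_enorm_lt_top hP0 (by simp),
      ENNReal.toReal_ofReal hP.le] at hfin
    have h := ENNReal.rpow_le_rpow (hsob f hf.1.continuous.measurable hfin.ne)
      (show 0 ≤ 1 / p by positivity)
    rw [eLpNorm_eq_lintegral_rpow_enorm_toReal hP0 (by simp), ENNReal.toReal_ofReal hP.le, gagliardo]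
    rwa [ENNReal.mul_rpow_of_nonneg _ _ (by positivity), ← ENNReal.rpow_mul,
      show (1 - σ) * (1 / p) = 1 / (p / (1 - σ)) by field_simp] at h
  obtain ⟨⟨hum, -⟩, φ, hφ, hlim⟩ := hu
  have hφm : ∀ n, AEStronglyMeasurable (φ n) μ := fun n => (hφ n).1.continuous.aestronglyMeasurable
  have hlim1 : Tendsto (fun n => eLpNorm (φ n - u) (ENNReal.ofReal p) μ) atTop (𝓝 0) := by
    refine tendsto_of_tendsto_of_tendsto_of_le_of_le tendsto_const_nhds hlim (fun _ => zero_le)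
      fun n => ?_
    rw [eLpNorm_sub_comm]
    exact le_self_add
  have hlim2 : Tendsto (fun n => H.gagliardo μ q s p fun x => u x - φ n x) atTop (𝓝 0) :=
    tendsto_of_tendsto_of_tendsto_of_le_of_le tendsto_const_nhds hlim (fun _ => zero_le)
      fun n => le_add_self
  obtain ⟨ns, hns, hae⟩ := (tendstoInMeasure_of_tendsto_eLpNorm (by simpa using hp0) hφm
    hum.aestronglyMeasurable hlim1).exists_seq_tendsto_ae
  refine (Lp.eLpNorm_lim_le_liminf_eLpNorm (fun n => hφm (ns n)) u hae).trans ?_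
  have hbound : ∀ n, eLpNorm (φ (ns n)) (ENNReal.ofReal (p / (1 - σ))) μ ≤ K ^ (1 / p) *
      (H.gagliardo μ q s p u + H.gagliardo μ q s p fun x => u x - φ (ns n) x) := by
    intro n
    refine (htest _ (hφ _)).trans (mul_le_mul_right ?_ _)
    rw [hq.gagliardo_eq_eLpNorm μ hp0, hq.gagliardo_eq_eLpNorm μ hp0, hq.gagliardo_eq_eLpNorm μ hp0]
    have hsub : H.weightedIncrement q s p (φ (ns n)) = H.weightedIncrement q s p u -
        H.weightedIncrement q s p (fun x => u x - φ (ns n) x) := by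
      ext z
      simp only [weightedIncrement, Pi.sub_apply]
      ring
    rw [hsub]
    exact eLpNorm_sub_le (hq.aestronglyMeasurable_weightedIncrement μ hum.aestronglyMeasurable)
      (hq.aestronglyMeasurable_weightedIncrement μ (hum.aestronglyMeasurable.sub (hφm _)))
      (ENNReal.one_le_ofReal.2 hp.le)
  have hlim3 := ENNReal.Tendsto.const_mul (a := K ^ (1 / p))
    ((tendsto_const_nhds (x := H.gagliardo μ q s p u)).add (hlim2.comp hns.tendsto_atTop))
    (Or.inr hK')
  rw [add_zero] at hlim3
  exact (liminf_le_liminf (Eventually.of_forall hbound)).trans_eq hlim3.liminf_eq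

end IsQuasiNorm

end HomogeneousGroup

/-- Hölder's inequality on a set of finite or infinite measure for the product of `w ∈ L^θ` with
`|u|^p`, where `u ∈ L^{p/(1-σ)}`. -/
theorem lintegral_enorm_mul_rpow_le {α : Type*} [MeasurableSpace α] {ν : Measure α} {w u : α → ℝ}
    {p θ σ : ℝ} (hp : 0 < p) (hθ : 0 < θ) (hσ : σ < 1) (hθσ : θ⁻¹ < σ)
    (hw : AEStronglyMeasurable w ν) (hu : AEStronglyMeasurable u ν) :
    ∫⁻ x, ‖w x‖ₑ * ‖u x‖ₑ ^ p ∂ν ≤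
      eLpNorm w (ENNReal.ofReal θ) ν * eLpNorm u (ENNReal.ofReal (p / (1 - σ))) ν ^ p *
        ν Set.univ ^ (σ - θ⁻¹) := by
  have h1σ : 0 < 1 - σ := sub_pos.2 hσ
  have hP : 0 < p / (1 - σ) := by positivity
  have h := ENNReal.lintegral_prod_norm_pow_le (μ := ν) (Finset.univ : Finset (Fin 3))
    (f := ![fun x => ‖w x‖ₑ ^ θ, fun x => ‖u x‖ₑ ^ (p / (1 - σ)), fun _ => 1])
    (p := ![θ⁻¹, 1 - σ, σ - θ⁻¹]) (by
      intro i _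
      fin_cases i
      · exact hw.enorm.pow_const _
      · exact hu.enorm.pow_const _
      · exact aemeasurable_const) (by simp [Fin.sum_univ_three]; ring) (by
      intro i _
      fin_cases i
      · exact (inv_pos.2 hθ).le
      · exact h1σ.le
      · exact (sub_pos.2 hθσ).le)
  simp only [Fin.prod_univ_three, Matrix.cons_val_zero, Matrix.cons_val_one, Matrix.cons_val,
    ENNReal.one_rpow, mul_one, lintegral_one, ← ENNReal.rpow_mul, mul_inv_cancel₀ hθ.ne',
    ENNReal.rpow_one, div_mul_cancel₀ _ h1σ.ne'] at h
  rw [eLpNorm_eq_lintegral_rpow_enorm_toReal (by simpa using hθ) (by simp),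
    eLpNorm_eq_lintegral_rpow_enorm_toReal (by simpa using hP) (by simp),
    ENNReal.toReal_ofReal hθ.le, ENNReal.toReal_ofReal hP.le, ← ENNReal.rpow_mul, one_div,
    show 1 / (p / (1 - σ)) * p = 1 - σ by field_simp]
  exact h

end HomGroup

end

theorem theorem3p1 {V : Type*} [NormedAddCommGroup V] [NormedSpace ℝ V] [FiniteDimensional ℝ V]
    [Group V] [MeasurableSpace V] [BorelSpace V] (H : HomGroup.HomogeneousGroup V)
    (μ : Measure V) [μ.IsHaarMeasure] (q : V → ℝ) (hq : H.IsQuasiNorm q)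
    (p s : ℝ) (hp : 1 < p) (hs : s ∈ Set.Ioo (0 : ℝ) 1) (hQ : s * p < H.homDim) :
    ∃ C : ℝ, 0 < C ∧
      ∀ (Ω : Set V), NullMeasurableSet Ω μ →
      ∀ θ : ℝ, H.homDim / (s * p) < θ →
      ∀ w : V → ℝ, MemLp w (ENNReal.ofReal θ) (μ.restrict Ω) →
        (∀ᵐ x ∂(μ.restrict Ω), 0 ≤ w x) →
      (∃ u : V → ℝ, H.IsWeakSolution μ q s p Ω w u ∧ ¬ (u =ᵐ[μ] fun _ => 0)) →
        ENNReal.ofReal C / HomGroup.innerQuasiRadius q Ω ^ (s * p - H.homDim / θ)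
          ≤ eLpNorm w (ENNReal.ofReal θ) (μ.restrict Ω) := by
  have hp0 : 0 < p := by linarith
  have hsp : 0 < s * p := mul_pos hs.1 hp0
  have hQ0 : 0 < H.homDim := hsp.trans hQ
  set σ : ℝ := s * p / H.homDim with hσdef
  have hσ : σ ∈ Set.Ioo (0 : ℝ) 1 := ⟨by positivity, (div_lt_one hQ0).2 hQ⟩
  have h1σ : 0 < 1 - σ := sub_pos.2 hσ.2
  have hσQ : σ * H.homDim = s * p := div_mul_cancel₀ _ hQ0.ne'
  obtain ⟨K, hK, hsob⟩ := hq.exists_sobolev μ hp hσ hQ0 hσQ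
  set M := max 1 (μ {x | q x ≤ 1}) with hM
  have hMt : M ≠ ⊤ := by simpa [hM] using hq.measure_sublevel_one_ne_top μ
  have hM1 : 1 ≤ M := le_max_left _ _
  set B : ℝ≥0∞ := max 1 (K ^ p * M ^ σ) with hB
  have hB1 : 1 ≤ B := le_max_left _ _
  have hBt : B ≠ ⊤ := by
    refine (max_lt ENNReal.one_lt_top (lt_top_iff_ne_top.2 ?_)).ne
    exact ENNReal.mul_ne_top (ENNReal.rpow_ne_top_of_nonneg hp0.le hK)
      (ENNReal.rpow_ne_top_of_nonneg hσ.1.le hMt)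
  have hB0 : B ≠ 0 := (one_pos.trans_le hB1).ne'
  refine ⟨(B⁻¹).toReal, ENNReal.toReal_pos (ENNReal.inv_ne_zero.2 hBt) (ENNReal.inv_ne_top.2 hB0), ?_⟩
  rintro Ω - θ hθ w hw - ⟨u, hu, hu0⟩
  rw [ENNReal.ofReal_toReal (ENNReal.inv_ne_top.2 hB0)]
  have hθ0 : 0 < θ := lt_trans (by positivity) hθ
  have hθσ : θ⁻¹ < σ := by
    rw [inv_lt_comm₀ hθ0 hσ.1, hσdef, inv_div]; exact hθ
  have hum := hu.mem.1.1.aestronglyMeasurable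
  set N := eLpNorm u (ENNReal.ofReal (p / (1 - σ))) μ with hN
  have hNt : N ≠ ⊤ := ((hsob Ω u hu.mem).trans_lt
    (ENNReal.mul_lt_top hK.lt_top hu.mem.1.2)).ne
  have hN0 : N ≠ 0 := fun h => hu0 ((eLpNorm_eq_zero_iff hum (by
    simpa using (show 0 < p / (1 - σ) by positivity))).1 h)
  have hNpt : N ^ p ≠ ⊤ := ENNReal.rpow_ne_top_of_nonneg hp0.le hNt
  have hNp0 : N ^ p ≠ 0 := (ENNReal.rpow_pos (pos_iff_ne_zero.2 hN0) hNt).ne'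
  set r := HomGroup.innerQuasiRadius q Ω with hr
  set W := eLpNorm w (ENNReal.ofReal θ) (μ.restrict Ω) with hW
  have hΩ : μ Ω ≤ r ^ H.homDim * M := by
    refine le_trans (measure_mono fun x hx => ?_)
      ((hq.measure_sublevel_le μ hQ0 r).trans (mul_le_mul_right (le_max_right _ _) _))
    exact le_iSup₂ (f := fun x (_ : x ∈ Ω) => ENNReal.ofReal (q x)) x hx
  have hΩ' : μ Ω ^ (σ - θ⁻¹) ≤ r ^ (s * p - H.homDim / θ) * M ^ σ := by
    have hpos : 0 ≤ σ - θ⁻¹ := (sub_pos.2 hθσ).le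
    refine (ENNReal.rpow_le_rpow hΩ hpos).trans ?_
    rw [ENNReal.mul_rpow_of_nonneg _ _ hpos, ← ENNReal.rpow_mul, mul_sub, mul_comm _ σ, hσQ,
      ← div_eq_mul_inv]
    exact mul_le_mul_right (ENNReal.rpow_le_rpow_of_exponent_le hM1 (by linarith [inv_pos.2 hθ0])) _
  have hmain : 1 * N ^ p ≤ (K ^ p * M ^ σ) * (W * r ^ (s * p - H.homDim / θ)) * N ^ p := by
    calc 1 * N ^ p ≤ (K * H.gagliardo μ q s p u) ^ p := by
          rw [one_mul]; exact ENNReal.rpow_le_rpow (hsob Ω u hu.mem) hp0.le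
      _ = K ^ p * H.gagliardo μ q s p u ^ p := ENNReal.mul_rpow_of_nonneg _ _ hp0.le
      _ ≤ K ^ p * (W * N ^ p * (r ^ (s * p - H.homDim / θ) * M ^ σ)) := by
          gcongr
          refine (hq.gagliardo_rpow_le_of_isWeakSolution μ hp0 hu).trans
            ((HomGroup.lintegral_enorm_mul_rpow_le hp0 hθ0 hσ.2 hθσ hw.aestronglyMeasurable
              hum.restrict).trans ?_)
          rw [Measure.restrict_apply_univ]
          gcongr
          exact eLpNorm_mono_measure u Measure.restrict_le_self
      _ = _ := by ring
  have h1 := (ENNReal.mul_le_mul_iff_left hNp0 hNpt).1 hmain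
  refine ENNReal.div_le_of_le_mul ?_
  rw [ENNReal.inv_le_iff_le_mul (fun _ => hB0) (fun h => absurd h hBt)]
  exact h1.trans (mul_le_mul_left (le_max_right _ _) _)
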